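/- Conventions. Let $X$ be a scheme. A sieve $H$ on $X$ belongs to the big Zariski site if it contains a Zariski open covering of $X$; $\mathcal C_H$ denotes the category of schemes over $X$ whose structure morphism lies in $H$, and the maximal sieve is denoted by $H_X$. A *standard vector bundle* on $X$ is a pair $(H,E)$ consisting of a sieve $H$ on $X$ belonging to the big Zariski site and a presheaf $E$ of modules on $\mathcal C_H$ over the presheaf of rings $Y\mapsto\mathcal O(Y)=\Gamma(Y,\mathcal O_Y)$ such that, for each $Y\in\mathcal C_H$, the module $E(Y)$ is equal to the standard free module $\mathcal O(Y)^{n_Y}$ for a specified integer $n_Y\ge 0$ and the standard basis of $E(Y)$ induces an isomorphism, on schemes over $Y$, from the presheaf $\mathcal O^{n_Y}$ to the pullback of $E$ to $Y$. It is a *standard line bundle* if all $n_Y$ equal $1$. The *trivial standard line bundle* $\mathcal O_X$ is the pair $(H_X,\ Y\mapsto\mathcal O(Y))$ with the usual restriction maps. The *pullback* of $(H,E)$ along $f:Y\to X$ is $(f^*H,f^*E)$, where $f^*H$ is the set of all $g:Z\to Y$ with $fg\in H$, and $(f^*E)(g)=E(fg)$ with the corresponding restriction maps. Let $\mathbb P^r_X=X\times_{\mathbb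 Z}\operatorname{Proj}\mathbb Z[x_0,\dots,x_r]$, let $i_k:U_k\to\mathbb P^r_X$ $(0\le k\le r)$ be the inclusion of the open subscheme where $x_k$ is invertible, and let $H$ be the sieve generated by $i_0,\dots,i_r$. For an integer $n$ let $\mathcal O(n)$ be the usual twisted sheaf of modules on $\mathbb P^r_X$. For $h:Y\to\mathbb P^r_X$ in $\mathcal C_H$ let $k$ be the largest index such that $h$ factors through $U_k$, write $h=i_kh_k$, and let $$\alpha_h:\ \mathcal O_Y\cong h_k^*\mathcal O_{U_k}\xrightarrow{\ h_k^*(x_k^n)\ }h_k^*i_k^*\mathcal O(n)\cong h^*\mathcal O(n)$$ be the isomorphism induced by multiplication by $x_k^n$; denote also by $\alpha_h:\mathcal O(Y)\to\Gamma(Y,h^*\mathcal O(n))$ the map induced on global sections. The *canonical standard line bundle* $\mathcal O_{\mathbb P^r_X}(n)$ is the pair $(H,E)$ where $E(h)=\mathcal O(Y)$ for $h:Y\to\mathbb P^r_X$ in $\mathcal C_H$, and where the restriction map of $E$ along a morphism $g:Z\to Y$ over $\mathbb P^r_X$ is the composite $$\mathcal O(Y)\xrightarrow{\ \alpha_h\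 }\Gamma(Y,h^*\mathcal O(n))\xrightarrow{\ g^*\ }\Gamma(Z,g^*h^*\mathcal O(n))\cong\Gamma(Z,(hg)^*\mathcal O(n))\xrightarrow{\ \alpha_{hg}^{-1}\ }\mathcal O(Z).$$ **Proposition.** Let $X$ be a scheme, let $i_\infty:X\to\mathbb P^1_X$ be the inclusion of the point $\infty=[0:1]$, and let $n$ be an integer. Then the standard line bundles $i_\infty^*\mathcal O_{\mathbb P^1_X}(n)$ and $\mathcal O_X$ on $X$ are equal (not merely isomorphic): their sieves are equal and their presheaves of modules are equal. -/

import Mathlib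

universe u

open CategoryTheory Limits AlgebraicGeometry TopologicalSpace Opposite

noncomputable section

namespace StandardBundle

section Twist

variable {A : Type u} {σ : Type*} [CommRing A] [SetLike σ A] [AddSubgroupClass σ A]
variable (𝒜 : ℕ → σ) [GradedRing 𝒜]

/-- The local ring `A_𝔭` (all fractions, no degree condition) at a point of `Proj 𝒜`. -/
abbrev LocalFractions (x : ProjectiveSpectrum 𝒜) : Type u :=
  Localization x.asHomogeneousIdeal.toIdeal.primeCompl

/-- `f` is given on all of `U` by one fraction `r / s` with `r, s` homogeneous and
`deg r - deg s = n`. -/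
def IsTwistedFraction (n : ℤ) {U : Opens (ProjectiveSpectrum.top 𝒜)}
    (f : ∀ x : U, LocalFractions 𝒜 x.1) : Prop :=
  ∃ (i j : ℕ) (_ : (i : ℤ) = j + n) (r s : A) (_ : r ∈ 𝒜 i) (_ : s ∈ 𝒜 j)
    (hs : ∀ x : U, s ∉ (show ProjectiveSpectrum 𝒜 from x.1).asHomogeneousIdeal),
    ∀ x : U, f x = Localization.mk r ⟨s, hs x⟩

/-- Being one fraction of degree `n`, as a prelocal predicate. -/
def twistedPrelocal (n : ℤ) :
    TopCat.PrelocalPredicate fun x : ProjectiveSpectrum.top 𝒜 => LocalFractions 𝒜 x where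
  pred f := IsTwistedFraction 𝒜 n f
  res := by
    rintro V U i f ⟨a, b, hab, r, s, hr, hs, h, w⟩
    exact ⟨a, b, hab, r, s, hr, hs, fun x => h (i x), fun x => w (i x)⟩

/-- Being locally a fraction of degree `n`. -/
def twistedLocal (n : ℤ) :
    TopCat.LocalPredicate fun x : ProjectiveSpectrum.top 𝒜 => LocalFractions 𝒜 x :=
  (twistedPrelocal 𝒜 n).sheafify

theorem exists_homogeneous_notMem (x : ProjectiveSpectrum 𝒜) :
    ∃ (m : ℕ) (s : A), 0 < m ∧ s ∈ 𝒜 m ∧ s ∉ x.asHomogeneousIdeal := by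
  classical
  by_contra! H
  refine x.not_irrelevant_le fun z hz ↦ ?_
  rw [← DirectSum.sum_support_decompose 𝒜 z]
  refine x.1.toIdeal.sum_mem fun k hk ↦ ?_
  rcases Nat.eq_zero_or_pos k with rfl | hk0
  · have h0 : GradedRing.proj 𝒜 0 z = 0 := (HomogeneousIdeal.mem_irrelevant_iff _ _).mp hz
    rw [GradedRing.proj_apply] at h0
    rw [h0]
    exact zero_mem _
  · exact H k _ hk0 (SetLike.coe_mem _)

/-- The sections of `𝒪(n)` over an open subset `U` of `Proj 𝒜`: the families of fractions
that are locally of the form `r / s` with `r, s` homogeneous and `deg r - deg s = n`. -/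
def twistedSections (n : ℤ) (U : (Opens (ProjectiveSpectrum.top 𝒜))ᵒᵖ) :
    AddSubgroup (∀ x : U.unop, LocalFractions 𝒜 x.1) where
  carrier := {f | (twistedLocal 𝒜 n).pred f}
  zero_mem' := by
    intro x
    obtain ⟨m, s, hm, hs, hx⟩ := exists_homogeneous_notMem 𝒜 x.1
    have hm' : (1 : ℤ) ≤ m := by exact_mod_cast hm
    have hle : (0 : ℤ) ≤ (m * n.natAbs : ℕ) + n := by
      push_cast
      rcases abs_cases n with h | h <;> rw [h.1] <;> nlinarith
    refine ⟨U.unop ⊓ ProjectiveSpectrum.basicOpen 𝒜 (s ^ n.natAbs), ⟨x.2, ?_⟩,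
      Opens.infLELeft _ _, (((m * n.natAbs : ℕ) : ℤ) + n).toNat, m * n.natAbs,
      Int.toNat_of_nonneg hle, 0, s ^ n.natAbs, zero_mem _, ?_, fun y => y.2.2, ?_⟩
    · exact fun h => hx (x.1.isPrime.mem_of_pow_mem _ h)
    · rw [mul_comm]; exact SetLike.pow_mem_graded _ hs
    · intro y
      exact (Localization.mk_zero _).symm
  add_mem' := by
    intro f g hf hg x
    obtain ⟨Va, ma, ia, i, j, hij, r, s, hr, hs, h, w⟩ := hf x
    obtain ⟨Vb, mb, ib, i', j', hij', r', s', hr', hs', h', w'⟩ := hg x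
    refine ⟨Va ⊓ Vb, ⟨ma, mb⟩, Opens.infLELeft _ _ ≫ ia, i + j', j + j',
      by push_cast; omega, r * s' + r' * s, s * s', ?_, SetLike.mul_mem_graded hs hs', ?_, ?_⟩
    · refine add_mem (SetLike.mul_mem_graded hr hs') ?_
      have : i + j' = i' + j := by omega
      rw [this]
      exact SetLike.mul_mem_graded hr' hs
    · intro y hy
      rcases (show ProjectiveSpectrum 𝒜 from y.1).isPrime.mem_or_mem hy with h1 | h1
      · exact h ⟨y.1, y.2.1⟩ h1
      · exact h' ⟨y.1, y.2.2⟩ h1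
    · intro y
      have e1 := w ⟨y.1, y.2.1⟩
      have e2 := w' ⟨y.1, y.2.2⟩
      refine (congrArg₂ (· + ·) e1 e2).trans ?_
      refine (Localization.add_mk _ _ _ _).trans ?_
      congr 1
      simp only
      ring
  neg_mem' := by
    intro f hf x
    obtain ⟨Va, ma, ia, i, j, hij, r, s, hr, hs, h, w⟩ := hf x
    refine ⟨Va, ma, ia, i, j, hij, -r, s, neg_mem hr, hs, h, fun y => ?_⟩
    exact (congrArg Neg.neg (w y)).trans (Localization.neg_mk _ _)

theorem smul_mem_twistedSections (n : ℤ) (U : (Opens (ProjectiveSpectrum.top 𝒜))ᵒᵖ)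
    (a : (ProjectiveSpectrum.Proj.structureSheaf 𝒜).1.obj U)
    (f : ∀ x : U.unop, LocalFractions 𝒜 x.1) (hf : f ∈ twistedSections 𝒜 n U) :
    (fun x => HomogeneousLocalization.val (a.1 x) * f x) ∈ twistedSections 𝒜 n U := by
  intro x
  obtain ⟨Va, ma, ia, i, ⟨r, hr⟩, ⟨s, hs⟩, h, w⟩ := a.2 x
  obtain ⟨Vb, mb, ib, i', j', hij', r', s', hr', hs', h', w'⟩ := hf x
  refine ⟨Va ⊓ Vb, ⟨ma, mb⟩, Opens.infLELeft _ _ ≫ ia, i + i', i + j',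
    by push_cast; omega, r * r', s * s', SetLike.mul_mem_graded hr hr',
    SetLike.mul_mem_graded hs hs', ?_, ?_⟩
  · intro y hy
    rcases (show ProjectiveSpectrum 𝒜 from y.1).isPrime.mem_or_mem hy with h1 | h1
    · exact h ⟨y.1, y.2.1⟩ h1
    · exact h' ⟨y.1, y.2.2⟩ h1
  · intro y
    have e1 := congrArg HomogeneousLocalization.val (w ⟨y.1, y.2.1⟩)
    have e2 := w' ⟨y.1, y.2.2⟩
    refine (congrArg₂ (· * ·) e1 e2).trans ?_
    exact (Localization.mk_mul _ _ _ _)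

instance twistedModule (n : ℤ) (U : (Opens (ProjectiveSpectrum.top 𝒜))ᵒᵖ) :
    Module ((ProjectiveSpectrum.Proj.structureSheaf 𝒜).1.obj U) (twistedSections 𝒜 n U) where
  smul a f := ⟨_, smul_mem_twistedSections 𝒜 n U a f.1 f.2⟩
  one_smul f := by
    refine Subtype.ext (funext fun x => ?_)
    exact (congrArg (· * f.1 x) (HomogeneousLocalization.val_one)).trans (one_mul _)
  mul_smul a b f := by
    refine Subtype.ext (funext fun x => ?_)
    exact (congrArg (· * f.1 x) (HomogeneousLocalization.val_mul _ _)).trans (mul_assoc _ _ _)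
  smul_zero a := Subtype.ext (funext fun x => mul_zero _)
  smul_add a f g := Subtype.ext (funext fun x => mul_add _ _ _)
  add_smul a b f := by
    refine Subtype.ext (funext fun x => ?_)
    exact (congrArg (· * f.1 x) (HomogeneousLocalization.val_add _ _)).trans (add_mul _ _ _)
  zero_smul f := by
    refine Subtype.ext (funext fun x => ?_)
    exact (congrArg (· * f.1 x) (HomogeneousLocalization.val_zero)).trans (zero_mul _)

/-- `𝒪(n)` as a presheaf of abelian groups on the space `Proj 𝒜`. -/
def twistedPresheaf (n : ℤ) : TopCat.Presheaf Ab.{u} (ProjectiveSpectrum.top 𝒜) where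
  obj U := AddCommGrpCat.of (twistedSections 𝒜 n U)
  map i := AddCommGrpCat.ofHom
    { toFun := fun f => ⟨fun x => f.1 (i.unop x), (twistedLocal 𝒜 n).res i.unop f.1 f.2⟩
      map_zero' := rfl
      map_add' := fun _ _ => rfl }

theorem twistedPresheaf_isSheaf (n : ℤ) : (twistedPresheaf 𝒜 n).IsSheaf := by
  rw [TopCat.Presheaf.isSheaf_iff_isSheaf_comp (forget Ab.{u})]
  exact TopCat.Presheaf.isSheaf_of_iso
    (NatIso.ofComponents (fun _ => Iso.refl _) (by intros; rfl))
    (TopCat.subsheafToTypes (twistedLocal 𝒜 n)).2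

instance (n : ℤ) (U : (Opens (Proj 𝒜))ᵒᵖ) :
    Module ((Proj 𝒜).ringCatSheaf.obj.obj U)
      ((show TopCat.Presheaf Ab.{u} (Proj 𝒜) from twistedPresheaf 𝒜 n).obj U) :=
  twistedModule 𝒜 n U

/-- Serre's twisting sheaf `𝒪(n)` on `Proj 𝒜`, as a sheaf of modules. -/
def twistedSheaf (n : ℤ) : (Proj 𝒜).Modules where
  val := PresheafOfModules.ofPresheaf
    (show TopCat.Presheaf Ab.{u} (Proj 𝒜) from twistedPresheaf 𝒜 n) (fun _ _ _ _ _ => rfl)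
  isSheaf := twistedPresheaf_isSheaf 𝒜 n

end Twist

section GlobalSections

variable {X Y Z W : Scheme.{u}}

/-- The structure sheaf of `X` as a sheaf of modules over itself. -/
abbrev structureModule (X : Scheme.{u}) : X.Modules := SheafOfModules.unit X.ringCatSheaf

/-- The group of global sections of a sheaf of modules. -/
def modSections (M : X.Modules) : Ab.{u} := Γ(M, (⊤ : X.Opens))

instance modSectionsModule (M : X.Modules) : Module Γ(X, ⊤) (modSections M) :=
  inferInstanceAs (Module Γ(X, ⊤) Γ(M, (⊤ : X.Opens)))

/-- The map on global sections induced by a morphism of sheaves of modules. -/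
def modMap {M N : X.Modules} (φ : M ⟶ N) : modSections M ⟶ modSections N := φ.app ⊤

theorem modMap_smul {M N : X.Modules} (φ : M ⟶ N) (a : Γ(X, ⊤)) (s : modSections M) :
    modMap φ (a • s) = a • modMap φ s :=
  Scheme.Modules.Hom.app_smul φ a s

theorem modMap_id (M : X.Modules) : modMap (𝟙 M) = 𝟙 (modSections M) := rfl

theorem modMap_comp {M N K : X.Modules} (φ : M ⟶ N) (ψ : N ⟶ K) :
    modMap (φ ≫ ψ) = modMap φ ≫ modMap ψ := rfl

theorem modMap_bijective {M N : X.Modules} (e : M ≅ N) : Function.Bijective (modMap e.hom) :=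
  Function.bijective_iff_has_inverse.mpr ⟨modMap e.inv,
    fun s => by rw [← ConcreteCategory.comp_apply, ← modMap_comp, e.hom_inv_id]; rfl,
    fun s => by rw [← ConcreteCategory.comp_apply, ← modMap_comp, e.inv_hom_id]; rfl⟩

/-- The map `M(Y) → N(Z)` induced by a morphism `M ⟶ g_* N`, where `g : Z ⟶ Y`. -/
def pushMap (g : Z ⟶ Y) {M : Y.Modules} {N : Z.Modules}
    (φ : M ⟶ (Scheme.Modules.pushforward g).obj N) : modSections M ⟶ modSections N := φ.app ⊤

theorem pushMap_smul (g : Z ⟶ Y) {M : Y.Modules} {N : Z.Modules}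
    (φ : M ⟶ (Scheme.Modules.pushforward g).obj N) (a : Γ(Y, ⊤)) (s : modSections M) :
    pushMap g φ (a • s) = g.appTop a • pushMap g φ s :=
  Scheme.Modules.Hom.app_smul φ a s

theorem pushMap_comp_left (g : Z ⟶ Y) {L M : Y.Modules} {N : Z.Modules} (ψ : L ⟶ M)
    (φ : M ⟶ (Scheme.Modules.pushforward g).obj N) :
    pushMap g (ψ ≫ φ) = modMap ψ ≫ pushMap g φ := rfl

theorem pushMap_comp_right (g : Z ⟶ Y) {M : Y.Modules} {N K : Z.Modules}
    (φ : M ⟶ (Scheme.Modules.pushforward g).obj N) (ψ : N ⟶ K) :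
    pushMap g (φ ≫ (Scheme.Modules.pushforward g).map ψ) = pushMap g φ ≫ modMap ψ := rfl

theorem pushMap_comp_modMap_smul (g : Z ⟶ Y) {M : Y.Modules} {N K : Z.Modules}
    (φ : M ⟶ (Scheme.Modules.pushforward g).obj N) (ψ : N ⟶ K) (a : Γ(Y, ⊤))
    (s : modSections M) :
    (pushMap g φ ≫ modMap ψ) (a • s) = g.appTop a • (pushMap g φ ≫ modMap ψ) s := by
  rw [← pushMap_comp_right, pushMap_smul]

theorem pushMap_id {M N : Y.Modules} (ψ : M ⟶ N) :
    pushMap (𝟙 Y) (ψ ≫ (Scheme.Modules.pushforwardId Y).inv.app N) = modMap ψ := rfl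

theorem pushMap_comp (g : Z ⟶ Y) (f : Y ⟶ X) {M : X.Modules} {N : Y.Modules} {K : Z.Modules}
    (φ : M ⟶ (Scheme.Modules.pushforward f).obj N)
    (ψ : N ⟶ (Scheme.Modules.pushforward g).obj K) :
    pushMap (g ≫ f) ((φ ≫ (Scheme.Modules.pushforward f).map ψ) ≫
      (Scheme.Modules.pushforwardComp g f).hom.app K) = pushMap f φ ≫ pushMap g ψ := rfl

/-- The section `1` of the structure sheaf. -/
def oneSection (X : Scheme.{u}) : modSections (structureModule X) := (1 : Γ(X, ⊤))

theorem modMap_eq_smul {M : X.Modules} (φ : structureModule X ⟶ M) (a : Γ(X, ⊤)) :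
    modMap φ (show Γ(X, ⊤) from a) = a • modMap φ (oneSection X) := by
  rw [← modMap_smul]
  congr 1
  exact (mul_one a).symm

end GlobalSections

section Pull

variable {X Y Z W : Scheme.{u}}

/-- Pulling back global sections, `M(Y) → (g^*M)(Z)` for `g : Z ⟶ Y`. -/
def pullbackSection (g : Z ⟶ Y) (M : Y.Modules) :
    modSections M ⟶ modSections ((Scheme.Modules.pullback g).obj M) :=
  pushMap g ((Scheme.Modules.pullbackPushforwardAdjunction g).unit.app M)

theorem pullbackSection_comp_smul (g : Z ⟶ Y) (M : Y.Modules) {N : Z.Modules}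
    (φ : (Scheme.Modules.pullback g).obj M ⟶ N) (a : Γ(Y, ⊤)) (s : modSections M) :
    (pullbackSection g M ≫ modMap φ) (a • s) = g.appTop a • (pullbackSection g M ≫ modMap φ) s :=
  pushMap_comp_modMap_smul g _ _ a s

theorem pullbackSection_naturality (g : Z ⟶ Y) {M N : Y.Modules} (φ : M ⟶ N) :
    modMap φ ≫ pullbackSection g N =
      pullbackSection g M ≫ modMap ((Scheme.Modules.pullback g).map φ) := by
  have h := (Scheme.Modules.pullbackPushforwardAdjunction g).unit.naturality φ
  rw [pullbackSection, pullbackSection, ← pushMap_comp_right, ← pushMap_comp_left]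
  exact congrArg (pushMap g) h

theorem pullbackSection_id (M : Y.Modules) :
    pullbackSection (𝟙 Y) M ≫ modMap ((Scheme.Modules.pullbackId Y).hom.app M) = 𝟙 _ := by
  have h := unit_conjugateEquiv .id (Scheme.Modules.pullbackPushforwardAdjunction (𝟙 Y))
    (Scheme.Modules.pullbackId Y).hom M
  rw [Scheme.Modules.conjugateEquiv_pullbackId_hom] at h
  rw [pullbackSection, ← pushMap_comp_right]
  exact (congrArg (pushMap (𝟙 Y)) h).symm.trans (pushMap_id (𝟙 M))

/-- The canonical isomorphism `g^* h^* F ≅ k^* F` for `k = g ≫ h`. -/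
def pullbackOver (F : X.Modules) (h : Y ⟶ X) (k : Z ⟶ X) (g : Z ⟶ Y) (w : g ≫ h = k) :
    (Scheme.Modules.pullback g).obj ((Scheme.Modules.pullback h).obj F) ≅
      (Scheme.Modules.pullback k).obj F :=
  (Scheme.Modules.pullbackComp g h ≪≫ Scheme.Modules.pullbackCongr w).app F

theorem pullbackSection_comp (g : Z ⟶ Y) (f : Y ⟶ X) (M : X.Modules) :
    pullbackSection f M ≫ pullbackSection g _ ≫ modMap (pullbackOver M f (g ≫ f) g rfl).hom =
      pullbackSection (g ≫ f) M := by
  have h := unit_conjugateEquiv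
    ((Scheme.Modules.pullbackPushforwardAdjunction f).comp
      (Scheme.Modules.pullbackPushforwardAdjunction g))
    (Scheme.Modules.pullbackPushforwardAdjunction (g ≫ f))
    (Scheme.Modules.pullbackComp g f).inv M
  rw [Scheme.Modules.conjugateEquiv_pullbackComp_inv, Adjunction.comp_unit_app] at h
  have h3 : pullbackSection f M ≫ pullbackSection g _ =
      pullbackSection (g ≫ f) M ≫ modMap (pullbackOver M f (g ≫ f) g rfl).inv := by
    rw [pullbackSection, pullbackSection, pullbackSection, ← pushMap_comp_right, ← pushMap_comp]
    refine (congrArg (pushMap (g ≫ f)) h).trans ?_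
    congr 2
  rw [← Category.assoc, h3, Category.assoc, ← modMap_comp, Iso.inv_hom_id]
  exact Category.comp_id _

theorem pullbackOver_id (F : X.Modules) (h : Y ⟶ X) (w : 𝟙 Y ≫ h = h) :
    (pullbackOver F h h (𝟙 Y) w).hom =
      (Scheme.Modules.pullbackId Y).hom.app ((Scheme.Modules.pullback h).obj F) := by
  have h1 := Scheme.Modules.pseudofunctor_right_unitality h
  rw [Iso.inv_comp_eq] at h1
  have h2 : (Scheme.Modules.pullbackComp (𝟙 Y) h).hom ≫ (Scheme.Modules.pullbackCongr w).hom =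
      Functor.whiskerLeft (Scheme.Modules.pullback h) (Scheme.Modules.pullbackId Y).hom ≫
        (Functor.rightUnitor _).hom := by
    rw [h1]
    rfl
  exact (congrArg (fun t => t.app F) h2).trans (Category.comp_id _)

theorem pullbackOver_comp (F : X.Modules) (h : Y ⟶ X) (k : Z ⟶ X) (l : W ⟶ X) (g : Z ⟶ Y)
    (g' : W ⟶ Z) (w : g ≫ h = k) (w' : g' ≫ k = l) (w'' : (g' ≫ g) ≫ h = l) :
    (Scheme.Modules.pullback g').map (pullbackOver F h k g w).hom ≫
        (pullbackOver F k l g' w').hom =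
      (pullbackOver ((Scheme.Modules.pullback h).obj F) g (g' ≫ g) g' rfl).hom ≫
        (pullbackOver F h l (g' ≫ g) w'').hom := by
  subst w
  subst w'
  have h1 := Scheme.Modules.pseudofunctor_associativity g' g h
  rw [Iso.inv_comp_eq] at h1
  have h2 : (Functor.whiskerRight (Scheme.Modules.pullbackComp g h).hom
        (Scheme.Modules.pullback g')) ≫ (Scheme.Modules.pullbackComp g' (g ≫ h)).hom =
      (Functor.associator _ _ _).hom ≫
        Functor.whiskerLeft (Scheme.Modules.pullback h) (Scheme.Modules.pullbackComp g' g).hom ≫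
        (Scheme.Modules.pullbackComp (g' ≫ g) h).hom ≫ (Scheme.Modules.pullbackCongr w'').hom := by
    have h3 : Functor.whiskerRight (Scheme.Modules.pullbackComp g h).hom
        (Scheme.Modules.pullback g') ≫ Functor.whiskerRight (Scheme.Modules.pullbackComp g h).inv
        (Scheme.Modules.pullback g') = 𝟙 _ := by
      rw [← Functor.whiskerRight_comp, Iso.hom_inv_id, Functor.whiskerRight_id']
    have h4 := congrArg (fun t => (Functor.whiskerRight (Scheme.Modules.pullbackComp g h).hom
        (Scheme.Modules.pullback g') ≫ t) ≫ (Scheme.Modules.pullbackCongr w'').hom) h1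
    simp only [reassoc_of% h3, Category.assoc, Scheme.Modules.pullbackCongr, eqToIso.hom,
      eqToHom_trans, eqToHom_refl, Category.comp_id] at h4
    exact h4.symm
  have h5 := congrArg (fun t => t.app F) h2
  refine Eq.trans ?_ (h5.trans (Category.id_comp _))
  exact congrArg₂ (fun s t => (Scheme.Modules.pullback g').map s ≫ t) (Category.comp_id _)
    (Category.comp_id _)

/-- The restriction map `(h^*F)(Y) → (g^*h^*F)(Z) ≅ (k^*F)(Z)` for `g : Z ⟶ Y` over `X`. -/
def bigRes (F : X.Modules) (h : Y ⟶ X) (k : Z ⟶ X) (g : Z ⟶ Y) (w : g ≫ h = k) :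
    modSections ((Scheme.Modules.pullback h).obj F) ⟶
      modSections ((Scheme.Modules.pullback k).obj F) :=
  pullbackSection g ((Scheme.Modules.pullback h).obj F) ≫ modMap (pullbackOver F h k g w).hom

theorem bigRes_smul (F : X.Modules) (h : Y ⟶ X) (k : Z ⟶ X) (g : Z ⟶ Y) (w : g ≫ h = k)
    (a : Γ(Y, ⊤)) (s : modSections ((Scheme.Modules.pullback h).obj F)) :
    bigRes F h k g w (a • s) = g.appTop a • bigRes F h k g w s :=
  pullbackSection_comp_smul g ((Scheme.Modules.pullback h).obj F) (pullbackOver F h k g w).hom a s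

theorem bigRes_id (F : X.Modules) (h : Y ⟶ X) (w : 𝟙 Y ≫ h = h) :
    bigRes F h h (𝟙 Y) w = 𝟙 _ := by
  rw [bigRes, pullbackOver_id, pullbackSection_id]

theorem bigRes_comp (F : X.Modules) (h : Y ⟶ X) (k : Z ⟶ X) (l : W ⟶ X) (g : Z ⟶ Y) (g' : W ⟶ Z)
    (w : g ≫ h = k) (w' : g' ≫ k = l) (w'' : (g' ≫ g) ≫ h = l) :
    bigRes F h k g w ≫ bigRes F k l g' w' = bigRes F h l (g' ≫ g) w'' := by
  rw [bigRes, bigRes, bigRes, ← pullbackSection_comp g' g, Category.assoc, Category.assoc,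
    Category.assoc, ← modMap_comp, ← pullbackOver_comp F h k l g g' w w' w'', modMap_comp,
    reassoc_of% pullbackSection_naturality g' (pullbackOver F h k g w).hom]

end Pull

section Units

variable {X Y Z : Scheme.{u}}

theorem final_opensMap (g : Z ⟶ Y) : (Opens.map g.base).Final where
  out U := by
    have : HasTerminal (StructuredArrow U (Opens.map g.base)) :=
      (IsTerminal.ofUniqueHom (Y := StructuredArrow.mk (Y := (⊤ : Opens Y)) (homOfLE le_top))
        (fun V => StructuredArrow.homMk (homOfLE le_top) rfl) (fun V m => by
          ext; exact Subsingleton.elim _ _)).hasTerminal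
    exact isConnected_of_hasTerminal _

theorem pushforward_isRightAdjoint (g : Z ⟶ Y) :
    (SheafOfModules.pushforward.{u} g.toRingCatSheafHom).IsRightAdjoint :=
  (Scheme.Modules.pullbackPushforwardAdjunction g).isRightAdjoint

theorem isIso_pullbackObjUnitToUnit {C D : Type u} [Category.{u} C] [Category.{u} D]
    {J : GrothendieckTopology C} {K : GrothendieckTopology D} {F : C ⥤ D}
    {S : Sheaf J RingCat.{u}} {R : Sheaf K RingCat.{u}} [Functor.IsContinuous F J K]
    (φ : S ⟶ (F.sheafPushforwardContinuous RingCat.{u} J K).obj R)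
    (h : (SheafOfModules.pushforward.{u} φ).IsRightAdjoint) (_ : F.Final) :
    IsIso (SheafOfModules.pullbackObjUnitToUnit φ) :=
  inferInstance

/-- The canonical isomorphism `g^* 𝒪_Y ≅ 𝒪_Z`. -/
def pullbackUnitIso (g : Z ⟶ Y) :
    (Scheme.Modules.pullback g).obj (structureModule Y) ≅ structureModule Z :=
  haveI := pushforward_isRightAdjoint g
  haveI := isIso_pullbackObjUnitToUnit g.toRingCatSheafHom (pushforward_isRightAdjoint g)
    (final_opensMap g)
  let e := asIso (C := SheafOfModules.{u} Z.ringCatSheaf)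
    (SheafOfModules.pullbackObjUnitToUnit g.toRingCatSheafHom)
  ⟨e.hom, e.inv, e.hom_inv_id, e.inv_hom_id⟩

/-- The morphism `𝒪_Y ⟶ g_* 𝒪_Z`. -/
def unitPush (g : Z ⟶ Y) :
    structureModule Y ⟶ (Scheme.Modules.pushforward g).obj (structureModule Z) :=
  SheafOfModules.unitToPushforwardObjUnit g.toRingCatSheafHom

theorem unit_pullbackUnitIso (g : Z ⟶ Y) :
    (Scheme.Modules.pullbackPushforwardAdjunction g).unit.app (structureModule Y) ≫
      (Scheme.Modules.pushforward g).map (pullbackUnitIso g).hom = unitPush g := by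
  have := pushforward_isRightAdjoint g
  have h := SheafOfModules.pullbackPushforwardAdjunction_homEquiv_pullbackObjUnitToUnit
    g.toRingCatSheafHom
  rw [Adjunction.homEquiv_unit] at h
  exact h

theorem pushMap_unitPush (g : Z ⟶ Y) : pushMap g (unitPush g) (oneSection Y) = oneSection Z :=
  map_one g.appTop.hom

theorem pullbackUnitIso_inv_one (g : Z ⟶ Y) :
    modMap (pullbackUnitIso g).inv (oneSection Z) =
      pullbackSection g (structureModule Y) (oneSection Y) := by
  rw [← pushMap_unitPush g, ← unit_pullbackUnitIso, pushMap_comp_right,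
    ← ConcreteCategory.comp_apply, Category.assoc, ← modMap_comp, Iso.hom_inv_id, modMap_id,
    Category.comp_id, pullbackSection]

end Units

section PowSection

variable {A : Type u} {σ : Type*} [CommRing A] [SetLike σ A] [AddSubgroupClass σ A]
variable (𝒜 : ℕ → σ) [GradedRing 𝒜]

/-- The fraction `x ^ n` (for an integer `n`) at a point where `x` does not vanish, written as
`x ^ max n 0 / x ^ max (-n) 0`. -/
def powFraction (n : ℤ) (x : A) (y : ProjectiveSpectrum 𝒜) (hy : x ∉ y.asHomogeneousIdeal) :
    LocalFractions 𝒜 y :=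
  Localization.mk (x ^ n.toNat) ⟨x ^ (-n).toNat, fun h => hy (y.isPrime.mem_of_pow_mem _ h)⟩

theorem mk_mul_powFraction (n : ℤ) (x : A) (y : ProjectiveSpectrum 𝒜)
    (hy : x ∉ y.asHomogeneousIdeal) (r s : A) (hs : s ∉ y.asHomogeneousIdeal)
    (hs' : s * x ^ n.toNat ∈ y.asHomogeneousIdeal.toIdeal.primeCompl) :
    Localization.mk (r * x ^ (-n).toNat) ⟨s * x ^ n.toNat, hs'⟩ * powFraction 𝒜 n x y hy =
      Localization.mk r (⟨s, hs⟩ : y.asHomogeneousIdeal.toIdeal.primeCompl) := by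
  rw [powFraction, Localization.mk_mul, Localization.mk_eq_mk_iff, Localization.r_iff_exists]
  refine ⟨1, ?_⟩
  simp only [Submonoid.coe_mul, OneMemClass.coe_one]
  ring

theorem mul_powFraction_injective (n : ℤ) (x : A) (y : ProjectiveSpectrum 𝒜)
    (hy : x ∉ y.asHomogeneousIdeal) :
    Function.Injective fun a : LocalFractions 𝒜 y => a * powFraction 𝒜 n x y hy := by
  have hu : IsUnit (powFraction 𝒜 n x y hy) := by
    refine IsUnit.of_mul_eq_one (Localization.mk (x ^ (-n).toNat)
      ⟨x ^ n.toNat, fun h => hy (y.isPrime.mem_of_pow_mem _ h)⟩) ?_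
    rw [powFraction, Localization.mk_mul, ← Localization.mk_one, Localization.mk_eq_mk_iff,
      Localization.r_iff_exists]
    refine ⟨1, ?_⟩
    simp only [Submonoid.coe_mul, OneMemClass.coe_one]
    ring
  exact hu.mul_left_injective

/-- `x ^ n` as a section of `𝒪(n)` over an open subset of `D₊(x)`, for `x` of degree one. -/
def powSection (n : ℤ) (x : A) (hx : x ∈ 𝒜 1) (U : Opens (ProjectiveSpectrum.top 𝒜))
    (hU : U ≤ ProjectiveSpectrum.basicOpen 𝒜 x) : twistedSections 𝒜 n (op U) :=
  ⟨fun y => powFraction 𝒜 n x y.1 (hU y.2), fun y =>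
    ⟨U, y.2, 𝟙 _, n.toNat, (-n).toNat, by omega, x ^ n.toNat, x ^ (-n).toNat,
      by simpa using SetLike.pow_mem_graded n.toNat hx,
      by simpa using SetLike.pow_mem_graded (-n).toNat hx,
      fun z h => hU z.2 ((show ProjectiveSpectrum 𝒜 from z.1).isPrime.mem_of_pow_mem _ h),
      fun _ => rfl⟩⟩

theorem smul_powSection_bijective (n : ℤ) (x : A) (hx : x ∈ 𝒜 1)
    (U : Opens (ProjectiveSpectrum.top 𝒜)) (hU : U ≤ ProjectiveSpectrum.basicOpen 𝒜 x) :
    Function.Bijective fun a : (ProjectiveSpectrum.Proj.structureSheaf 𝒜).1.obj (op U) =>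
      (twistedModule 𝒜 n (op U)).smul a (powSection 𝒜 n x hx U hU) := by
  constructor
  · intro a b h
    refine Subtype.ext (funext fun y => HomogeneousLocalization.val_injective _ ?_)
    exact mul_powFraction_injective 𝒜 n x y.1 (hU y.2) (congrFun (congrArg Subtype.val h) y)
  · intro f
    have key : ∀ y : U, ∃ (V : Opens (ProjectiveSpectrum.top 𝒜)) (_ : y.1 ∈ V) (i : V ⟶ U)
        (d : ℕ) (r s : 𝒜 d) (hs : ∀ z : V, s.1 ∉
          (show ProjectiveSpectrum 𝒜 from z.1).asHomogeneousIdeal), ∀ z : V,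
        (Localization.mk r.1 ⟨s.1, hs z⟩ : LocalFractions 𝒜 z.1) *
          powFraction 𝒜 n x z.1 (hU (i z).2) = f.1 (i z) := by
      intro y
      obtain ⟨V, hy, i, a, b, hab, r, s, hr, hs, h, w⟩ := f.2 y
      have hd : a + (-n).toNat = b + n.toNat := by omega
      refine ⟨V, hy, i, b + n.toNat, ⟨r * x ^ (-n).toNat, ?_⟩, ⟨s * x ^ n.toNat, ?_⟩, ?_, ?_⟩
      · rw [← hd]
        exact SetLike.mul_mem_graded hr (by simpa using SetLike.pow_mem_graded (-n).toNat hx)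
      · exact SetLike.mul_mem_graded hs (by simpa using SetLike.pow_mem_graded n.toNat hx)
      · intro z hz
        have hp := (show ProjectiveSpectrum 𝒜 from z.1).isPrime
        rcases hp.mem_or_mem hz with h1 | h1
        · exact h z h1
        · exact hU (i z).2 (hp.mem_of_pow_mem _ h1)
      · intro z
        exact (mk_mul_powFraction 𝒜 n x z.1 (hU (i z).2) r s (h z) _).trans (w z).symm
    have pt : ∀ y : U, ∃ c : HomogeneousLocalization.AtPrime 𝒜
        (show ProjectiveSpectrum 𝒜 from y.1).asHomogeneousIdeal.toIdeal,
        c.val * powFraction 𝒜 n x y.1 (hU y.2) = f.1 y := by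
      intro y
      obtain ⟨V, hy, i, d, r, s, hs, h⟩ := key y
      exact ⟨.mk ⟨d, r, s, hs ⟨y.1, hy⟩⟩, h ⟨y.1, hy⟩⟩
    choose c hc using pt
    refine ⟨⟨c, fun y => ?_⟩, Subtype.ext (funext hc)⟩
    obtain ⟨V, hy, i, d, r, s, hs, h⟩ := key y
    refine ⟨V, hy, i, d, r, s, hs, fun z => HomogeneousLocalization.val_injective _ ?_⟩
    exact mul_powFraction_injective 𝒜 n x z.1 (hU (i z).2) ((hc (i z)).trans (h z).symm)

/-- Multiplication by `x ^ n` as a morphism `𝒪 → 𝒪(n)|_{D₊(x)}` of sheaves of modules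
on `D₊(x)`. -/
def mulPow (n : ℤ) (x : A) (hx : x ∈ 𝒜 1) :
    structureModule (Proj.basicOpen 𝒜 x).toScheme ⟶
      (twistedSheaf 𝒜 n).restrict (Proj.basicOpen 𝒜 x).ι :=
  (SheafOfModules.unitHomEquiv ((twistedSheaf 𝒜 n).restrict (Proj.basicOpen 𝒜 x).ι)).symm
    (PresheafOfModules.sectionsMk
      (fun W => powSection 𝒜 n x hx ((Proj.basicOpen 𝒜 x).ι ''ᵁ W.unop)
        (by rintro _ ⟨y, _, rfl⟩; exact y.2))
      (fun _ _ _ => rfl))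

instance isIso_mulPow (n : ℤ) (x : A) (hx : x ∈ 𝒜 1) : IsIso (mulPow 𝒜 n x hx) := by
  rw [Scheme.Modules.Hom.isIso_iff_isIso_app]
  intro W
  rw [ConcreteCategory.isIso_iff_bijective]
  have hW : (Proj.basicOpen 𝒜 x).ι ''ᵁ W ≤ Proj.basicOpen 𝒜 x := by
    rintro _ ⟨y, _, rfl⟩; exact y.2
  have h1 := smul_powSection_bijective 𝒜 n x hx ((Proj.basicOpen 𝒜 x).ι ''ᵁ W) hW
  have h2 : Function.Bijective ((Proj.basicOpen 𝒜 x).ι.appIso W).inv :=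
    (ConcreteCategory.isIso_iff_bijective _).mp inferInstance
  exact h1.comp h2

end PowSection

section Sieves

variable {X Y : Scheme.{u}}

/-- The big structure sheaf restricted to a sieve `H` on `X`: it sends `Y ⟶ X` in `H` to the ring
of global sections of `Y`. -/
abbrev bigStructureSheaf (H : Sieve X) : H.arrows.categoryᵒᵖ ⥤ CommRingCat.{u} :=
  (Presieve.diagram H.arrows).op ⋙ Scheme.Γ

/-- The ring of global sections of an object of the category of a sieve. -/
abbrev globalSections {H : Sieve X} (V : H.arrows.category) : CommRingCat.{u} := Γ(V.obj.left, ⊤)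

/-- The pullback of functions along a morphism of the category of a sieve. -/
abbrev globalRes {H : Sieve X} {V W : H.arrows.category} (g : W ⟶ V) :
    globalSections V →+* globalSections W := g.hom.left.appTop.hom

/-- Presheaves of modules on a sieve, over the big structure sheaf. -/
abbrev SievePresheaf (H : Sieve X) : Type _ :=
  PresheafOfModules.{u} (bigStructureSheaf H ⋙ forget₂ CommRingCat RingCat)

/-- A standard vector bundle `(H, E)` on `X`: a sieve `H` on `X` belonging to the Zariski topology
and a presheaf of modules `E` on `H` whose value at each `V` is *literally* a standard free module
`𝒪(V)^n` (so that `E` amounts to the numbers `n` and the restriction maps), such that for each `V`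
the standard basis of `E(V) = 𝒪(V)^n` induces an isomorphism from the presheaf `𝒪^n` on schemes
over `V` to the pullback of `E` to `V`. -/
structure StandardVectorBundle (X : Scheme.{u}) where
  sieve : Sieve X
  mem_zariskiTopology : sieve ∈ Scheme.zariskiTopology X
  rank : sieve.arrows.category → ℕ
  res : ∀ {V W : sieve.arrows.category} (g : W ⟶ V),
    (Fin (rank V) → globalSections V) →ₛₗ[globalRes g] (Fin (rank W) → globalSections W)
  res_id : ∀ (V : sieve.arrows.category) (a : Fin (rank V) → globalSections V), res (𝟙 V) a = a
  res_comp : ∀ {V W T : sieve.arrows.category} (g : W ⟶ V) (g' : T ⟶ W)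
    (a : Fin (rank V) → globalSections V), res (g' ≫ g) a = res g' (res g a)
  basis_bijective : ∀ {V W : sieve.arrows.category} (g : W ⟶ V),
    Function.Bijective fun a : Fin (rank V) → globalSections W =>
      ∑ j, a j • res g (Pi.single j 1)

/-- Sections of a presheaf of modules on a sieve. -/
abbrev SievePresheaf.sections {H : Sieve X} (E : SievePresheaf H) (V : H.arrows.category) :
    Type u := E.obj (op V)

instance {H : Sieve X} (E : SievePresheaf H) (V : H.arrows.category) :
    Module (globalSections V) (E.sections V) := (E.obj (op V)).isModule

/-- The restriction maps of a presheaf of modules on a sieve. -/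
def SievePresheaf.res {H : Sieve X} (E : SievePresheaf H) {V W : H.arrows.category} (g : W ⟶ V) :
    E.sections V →ₛₗ[globalRes g] E.sections W where
  toFun s := E.map g.op s
  map_add' s t := map_add (E.map g.op).hom s t
  map_smul' a s := E.map_smul g.op a s

theorem SievePresheaf.res_id {H : Sieve X} (E : SievePresheaf H) (V : H.arrows.category)
    (s : E.sections V) : E.res (𝟙 V) s = s := by
  change E.map (𝟙 (op V)) s = s
  rw [E.map_id]
  rfl

theorem SievePresheaf.res_comp {H : Sieve X} (E : SievePresheaf H) {V W T : H.arrows.category}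
    (g : W ⟶ V) (g' : T ⟶ W) (s : E.sections V) : E.res (g' ≫ g) s = E.res g' (E.res g s) := by
  change E.map (g.op ≫ g'.op) s = _
  rw [E.map_comp]
  rfl

/-- A trivialization of `E` over `V`: the images in `E(V)` of the standard basis under an
isomorphism from the presheaf `𝒪^n` on schemes over `V` to the pullback of `E` to `V`. -/
structure Trivialization {H : Sieve X} (E : SievePresheaf H) (V : H.arrows.category) where
  rank : ℕ
  basis : Fin rank → E.sections V
  bijective : ∀ {W : H.arrows.category} (g : W ⟶ V),
    Function.Bijective fun a : Fin rank → globalSections W => ∑ j, a j • E.res g (basis j)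

/-- The isomorphism `φ(V) : 𝒪(V)^n ≅ E(V)` on sections over `V` given by a trivialization. -/
def Trivialization.equiv {H : Sieve X} {E : SievePresheaf H} {V : H.arrows.category}
    (φ : Trivialization E V) : (Fin φ.rank → globalSections V) ≃ₗ[globalSections V] E.sections V :=
  LinearEquiv.ofBijective (Fintype.linearCombination (globalSections V) φ.basis) (by
    have h := φ.bijective (𝟙 V)
    simp only [SievePresheaf.res_id] at h
    exact h)

namespace StandardVectorBundle

/-- The presheaf of modules underlying a standard vector bundle. -/
def toSievePresheaf (E : StandardVectorBundle X) : SievePresheaf E.sieve where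
  obj V := ModuleCat.of (globalSections V.unop) (Fin (E.rank V.unop) → globalSections V.unop)
  map {V W} g := ModuleCat.semilinearMapAddEquiv (globalRes g.unop)
    (ModuleCat.of (globalSections V.unop) (Fin (E.rank V.unop) → globalSections V.unop))
    (ModuleCat.of (globalSections W.unop) (Fin (E.rank W.unop) → globalSections W.unop))
    (E.res g.unop)
  map_id V := by
    refine ModuleCat.hom_ext (LinearMap.ext fun a => ?_)
    exact E.res_id V.unop a
  map_comp g g' := by
    refine ModuleCat.hom_ext (LinearMap.ext fun a => ?_)
    exact E.res_comp g.unop g'.unop a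

/-- The trivial standard vector bundle of rank `n`: the sieve is the maximal one, the value at
`Y ⟶ X` is `𝒪(Y)^n`, and the restriction maps act coordinatewise. -/
def trivial (X : Scheme.{u}) (n : ℕ) : StandardVectorBundle X where
  sieve := ⊤
  mem_zariskiTopology := Scheme.zariskiTopology.top_mem X
  rank _ := n
  res {V W} g :=
    { toFun := fun a j => globalRes g (a j)
      map_add' := fun a b => funext fun j => map_add _ _ _
      map_smul' := fun c a => funext fun j => map_mul _ _ _ }
  res_id V a := funext fun j => by
    change (𝟙 V.obj.left : V.obj.left ⟶ V.obj.left).appTop (a j) = a j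
    rw [Scheme.Hom.id_appTop]
    rfl
  res_comp g g' a := funext fun j => by
    change (g'.hom.left ≫ g.hom.left).appTop (a j) = _
    rw [Scheme.Hom.comp_appTop]
    rfl
  basis_bijective {V W} g := by
    convert Function.bijective_id using 1
    funext a i
    simp [Pi.single_apply, Finset.sum_apply, apply_ite]

/-- The functor `(Z ⟶ Y) ↦ (Z ⟶ Y ⟶ X)` from the category of `f^* H` to the category of `H`. -/
def pullbackSieveFunctor (f : Y ⟶ X) (H : Sieve X) :
    (H.pullback f).arrows.category ⥤ H.arrows.category where
  obj V := ⟨Over.mk (V.obj.hom ≫ f), V.property⟩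
  map {V W} g := ObjectProperty.homMk (Over.homMk g.hom.left (by
    change g.hom.left ≫ W.obj.hom ≫ f = V.obj.hom ≫ f
    rw [Over.w_assoc]))

/-- The pullback of a standard vector bundle: `(f^*H, f^*E)` with `(f^*E)(Z ⟶ Y) = E(Z ⟶ Y ⟶ X)`. -/
def pullback (f : Y ⟶ X) (E : StandardVectorBundle X) : StandardVectorBundle Y where
  sieve := E.sieve.pullback f
  mem_zariskiTopology := Scheme.zariskiTopology.pullback_stable f E.mem_zariskiTopology
  rank V := E.rank ((pullbackSieveFunctor f E.sieve).obj V)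
  res g := E.res ((pullbackSieveFunctor f E.sieve).map g)
  res_id V a := (congrArg (fun g => E.res g a)
    ((pullbackSieveFunctor f E.sieve).map_id V)).trans (E.res_id _ a)
  res_comp g g' a := (congrArg (fun g => E.res g a)
    ((pullbackSieveFunctor f E.sieve).map_comp g' g)).trans (E.res_comp _ _ a)
  basis_bijective g := E.basis_bijective ((pullbackSieveFunctor f E.sieve).map g)

/-- The standardization of a presheaf `E` on the sieve `H` along trivializations `φ_V`: its value at
`V` is `𝒪(V)^n`, and its restriction along `g : W ⟶ V` is `φ_W⁻¹ ∘ E(g) ∘ φ_V`. -/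
def standardize {H : Sieve X} (hH : H ∈ Scheme.zariskiTopology X) (E : SievePresheaf H)
    (φ : ∀ V : H.arrows.category, Trivialization E V) : StandardVectorBundle X where
  sieve := H
  mem_zariskiTopology := hH
  rank V := (φ V).rank
  res {V W} g :=
    { toFun := fun a => (φ W).equiv.symm (E.res g ((φ V).equiv a))
      map_add' := fun a b => by simp only [map_add]
      map_smul' := fun c a => by
        rw [map_smul, LinearMap.map_smulₛₗ, map_smul] }
  res_id V a := by
    change (φ V).equiv.symm (E.res (𝟙 V) ((φ V).equiv a)) = a
    rw [SievePresheaf.res_id, LinearEquiv.symm_apply_apply]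
  res_comp {V W T} g g' a := by
    change (φ T).equiv.symm (E.res (g' ≫ g) ((φ V).equiv a)) =
      (φ T).equiv.symm (E.res g' ((φ W).equiv ((φ W).equiv.symm (E.res g ((φ V).equiv a)))))
    rw [LinearEquiv.apply_symm_apply, SievePresheaf.res_comp]
  basis_bijective {V W} g := by
    have h := (φ W).equiv.symm.bijective.comp ((φ V).bijective g)
    convert h using 1
    funext a
    change _ = (φ W).equiv.symm (∑ j, a j • E.res g ((φ V).basis j))
    rw [map_sum]
    refine Finset.sum_congr rfl fun j _ => ?_
    rw [map_smul]
    have key : (φ V).equiv (Pi.single j 1) = (φ V).basis j := by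
      refine (LinearEquiv.ofBijective_apply _ _).trans ?_
      rw [Fintype.linearCombination_apply_single, one_smul]
    exact congrArg (fun t => a j • (φ W).equiv.symm (E.res g t)) key

end StandardVectorBundle

end Sieves

section ModuleFamilies

variable {X Y Z : Scheme.{u}}

/-- The global sections of a sheaf of modules, as a module. -/
def globalModule (M : Y.Modules) : ModuleCat.{u} Γ(Y, ⊤) :=
  ModuleCat.of Γ(Y, ⊤) (modSections M)

/-- An additive map between global sections of sheaves of modules that is semilinear, as a
semilinear map. -/
def globalMap {M : Y.Modules} {N : Z.Modules} (g : Z ⟶ Y) (ρ : modSections M ⟶ modSections N)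
    (h : ∀ (a : Γ(Y, ⊤)) (s : modSections M), ρ (a • s) = g.appTop a • ρ s) :
    globalModule M →ₛₗ[g.appTop.hom] globalModule N where
  toFun s := ρ s
  map_add' s t := map_add ρ.hom s t
  map_smul' a s := h a s

/-- A family of sheaves of modules `M_V` on the schemes `V` in a sieve, with compatible semilinear
maps `M_V(V) → M_W(W)` for `W ⟶ V`, gives a presheaf of modules `V ↦ M_V(V)` on the sieve. -/
def SievePresheaf.ofFamily {H : Sieve X} (M : ∀ V : H.arrows.category, V.obj.left.Modules)
    (ρ : ∀ {V W : H.arrows.category} (_ : W ⟶ V), modSections (M V) ⟶ modSections (M W))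
    (ρ_smul : ∀ {V W : H.arrows.category} (g : W ⟶ V) (a : Γ(V.obj.left, ⊤)) (s : modSections (M V)),
      ρ g (a • s) = g.hom.left.appTop a • ρ g s)
    (ρ_id : ∀ V : H.arrows.category, ρ (𝟙 V) = 𝟙 modSections (M V))
    (ρ_comp : ∀ {V W T : H.arrows.category} (g : W ⟶ V) (g' : T ⟶ W),
      ρ g ≫ ρ g' = ρ (g' ≫ g)) : SievePresheaf H where
  obj V := globalModule (M V.unop)
  map {V W} g := ModuleCat.semilinearMapAddEquiv (globalRes g.unop)
    (globalModule (M V.unop)) (globalModule (M W.unop))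
    (globalMap g.unop.hom.left (ρ g.unop) (ρ_smul g.unop))
  map_id V := by
    refine ModuleCat.hom_ext (LinearMap.ext fun s => ?_)
    exact congrArg (fun t : modSections (M V.unop) ⟶ modSections (M V.unop) => t s) (ρ_id V.unop)
  map_comp {V W T} g g' := by
    refine ModuleCat.hom_ext (LinearMap.ext fun s => ?_)
    exact congrArg (fun t : modSections (M V.unop) ⟶ modSections (M T.unop) => t s)
      (ρ_comp g.unop g'.unop).symm

theorem smul_one_bijective {M : Y.Modules} (e : structureModule Y ≅ M) :
    Function.Bijective fun a : Γ(Y, ⊤) => a • modMap e.hom (oneSection Y) := by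
  have h1 := modMap_bijective e
  have h2 : (fun a : Γ(Y, ⊤) => a • modMap e.hom (oneSection Y)) =
      modMap e.hom := funext fun a => (modMap_eq_smul e.hom a).symm
  rw [h2]
  exact h1

/-- A rank one trivialization over `V` of the presheaf given by a family of sheaves of modules: the
global section given by `𝒪_V ≅ M_V`, when its restriction along any `g : W ⟶ V` is given by
an isomorphism `𝒪_W ≅ M_W`. -/
def Trivialization.ofIso {H : Sieve X} (M : ∀ V : H.arrows.category, V.obj.left.Modules)
    (ρ : ∀ {V W : H.arrows.category} (_ : W ⟶ V), modSections (M V) ⟶ modSections (M W))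
    (ρ_smul : ∀ {V W : H.arrows.category} (g : W ⟶ V) (a : Γ(V.obj.left, ⊤)) (s : modSections (M V)),
      ρ g (a • s) = g.hom.left.appTop a • ρ g s)
    (ρ_id : ∀ V : H.arrows.category, ρ (𝟙 V) = 𝟙 modSections (M V))
    (ρ_comp : ∀ {V W T : H.arrows.category} (g : W ⟶ V) (g' : T ⟶ W),
      ρ g ≫ ρ g' = ρ (g' ≫ g))
    (V : H.arrows.category) (α : structureModule V.obj.left ≅ M V)
    (β : ∀ {W : H.arrows.category} (_ : W ⟶ V), structureModule W.obj.left ≅ M W)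
    (hβ : ∀ {W : H.arrows.category} (g : W ⟶ V),
      ρ g (modMap α.hom (oneSection V.obj.left)) =
        modMap (β g).hom (oneSection W.obj.left)) :
    Trivialization (SievePresheaf.ofFamily M ρ ρ_smul ρ_id ρ_comp) V where
  rank := 1
  basis _ := modMap α.hom (oneSection V.obj.left)
  bijective {W} g := by
    have h1 := smul_one_bijective (β g)
    have h2 : Function.Bijective fun a : Fin 1 → globalSections W => a 0 :=
      (Equiv.funUnique (Fin 1) (globalSections W)).bijective
    have h3 := h1.comp h2
    rw [← hβ g] at h3
    have h4 : (fun a : Fin 1 → globalSections W => ∑ _j : Fin 1, a _j •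
        (SievePresheaf.ofFamily M ρ ρ_smul ρ_id ρ_comp).res g
          (modMap α.hom (oneSection V.obj.left))) =
        fun a => a 0 • (SievePresheaf.ofFamily M ρ ρ_smul ρ_id ρ_comp).res g
          (modMap α.hom (oneSection V.obj.left)) :=
      funext fun a => Fin.sum_univ_one _
    rw [h4]
    exact h3

end ModuleFamilies

section BigExtension

variable {X Y Z U : Scheme.{u}}

theorem frame_one {M : U.Modules} (e : structureModule U ≅ M) (p : Y ⟶ U) :
    modMap ((pullbackUnitIso p).symm ≪≫ (Scheme.Modules.pullback p).mapIso e).hom (oneSection Y) =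
      pullbackSection p M (modMap e.hom (oneSection U)) := by
  have h1 := ConcreteCategory.congr_hom (pullbackSection_naturality p e.hom) (oneSection U)
  rw [ConcreteCategory.comp_apply, ConcreteCategory.comp_apply, ← pullbackUnitIso_inv_one] at h1
  rw [h1, Iso.trans_hom, modMap_comp, ConcreteCategory.comp_apply, Iso.symm_hom, Functor.mapIso_hom]

theorem frame_trans_one {M : U.Modules} (e : structureModule U ≅ M) (p : Y ⟶ U) {N : Y.Modules}
    (f : (Scheme.Modules.pullback p).obj M ≅ N) :
    modMap ((pullbackUnitIso p).symm ≪≫ (Scheme.Modules.pullback p).mapIso e ≪≫ f).hom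
        (oneSection Y) =
      (pullbackSection p M ≫ modMap f.hom) (modMap e.hom (oneSection U)) := by
  rw [← Iso.trans_assoc, Iso.trans_hom, modMap_comp, ConcreteCategory.comp_apply, frame_one,
    ConcreteCategory.comp_apply]

theorem eq_of_comp_eq {A B C : Ab.{u}} {f : A ⟶ B} {g : B ⟶ C} {k : A ⟶ C} (e : f ≫ g = k) {x : A}
    {y : B} {z : C} (hy : y = f x) (hz : z = k x) : g y = z := by
  rw [hy, hz, ← e]
  rfl

variable {H : Sieve X}

/-- The morphism `V ⟶ X` underlying an object of the category of a sieve on `X`. -/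
def toBase (V : H.arrows.category) : V.obj.left ⟶ X := V.obj.hom

/-- The morphism of schemes underlying a morphism of the category of a sieve. -/
def underlying {V W : H.arrows.category} (g : W ⟶ V) : W.obj.left ⟶ V.obj.left := g.hom.left

theorem underlying_toBase {V W : H.arrows.category} (g : W ⟶ V) :
    underlying g ≫ toBase V = toBase W :=
  Over.w g.hom

/-- The sheaf `h^*F` on `Y`, for an object `h : Y ⟶ X` of the category of a sieve. -/
def bigModule (F : X.Modules) (V : H.arrows.category) : V.obj.left.Modules :=
  (Scheme.Modules.pullback (toBase V)).obj F

/-- The isomorphism `g^* h^*F ≅ k^*F` for a morphism `g` from `k : Z ⟶ X` to `h : Y ⟶ X` in the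
category of a sieve. -/
def bigOver (F : X.Modules) {V W : H.arrows.category} (g : W ⟶ V) :
    (Scheme.Modules.pullback (underlying g)).obj (bigModule F V) ≅ bigModule F W :=
  pullbackOver F (toBase V) (toBase W) (underlying g) (underlying_toBase g)

/-- The restriction map `(h^*F)(Y) → (g^*h^*F)(Z) ≅ (k^*F)(Z)` along a morphism `g` from `k : Z ⟶ X`
to `h : Y ⟶ X` in the category of a sieve. -/
def bigRestriction (F : X.Modules) {V W : H.arrows.category} (g : W ⟶ V) :
    modSections (bigModule F V) ⟶ modSections (bigModule F W) :=
  pullbackSection (underlying g) (bigModule F V) ≫ modMap (bigOver F g).hom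

theorem bigRestriction_smul (F : X.Modules) {V W : H.arrows.category} (g : W ⟶ V)
    (a : Γ(V.obj.left, ⊤)) (s : modSections (bigModule F V)) :
    bigRestriction F g (a • s) = (underlying g).appTop a • bigRestriction F g s :=
  pullbackSection_comp_smul (underlying g) (bigModule F V) (bigOver F g).hom a s

theorem bigRestriction_id (F : X.Modules) (V : H.arrows.category) :
    bigRestriction F (𝟙 V) = 𝟙 (modSections (bigModule F V)) :=
  bigRes_id F (toBase V) (Category.id_comp _)

theorem bigRestriction_comp (F : X.Modules) {V W T : H.arrows.category} (g : W ⟶ V) (g' : T ⟶ W) :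
    bigRestriction F g ≫ bigRestriction F g' = bigRestriction F (g' ≫ g) :=
  bigRes_comp F (toBase V) (toBase W) (toBase T) (underlying g) (underlying g')
      (underlying_toBase g) (underlying_toBase g') (underlying_toBase (g' ≫ g))

variable (H) in
/-- The extension of a sheaf of modules `F` on `X` to the big Zariski site, restricted to a sieve
`H`: its value at `h : Y ⟶ X` is `(h^*F)(Y)`, and the restriction along `g : Z ⟶ Y` is
`(h^*F)(Y) → (g^*h^*F)(Z) ≅ (k^*F)(Z)`. -/
def bigExtension (F : X.Modules) : SievePresheaf H :=
  SievePresheaf.ofFamily (bigModule F) (bigRestriction F) (bigRestriction_smul F) (bigRestriction_id F)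
    (bigRestriction_comp F)

theorem underlying_comp {i : U ⟶ X} {V W : H.arrows.category} (p : V.obj.left ⟶ U)
    (w : p ≫ i = toBase V) (g : W ⟶ V) : (underlying g ≫ p) ≫ i = toBase W := by
  rw [Category.assoc, w]
  exact underlying_toBase g

section Frames

variable {F : X.Modules} {i : U ⟶ X} (e : structureModule U ≅ (Scheme.Modules.pullback i).obj F)
variable (V : H.arrows.category) (p : V.obj.left ⟶ U) (w : p ≫ i = toBase V)

/-- The isomorphism `p^* i^* F ≅ h^* F` for a factorization `h = p ≫ i` of an object `h : Y ⟶ X`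
of the category of a sieve. -/
def frameOver (F : X.Modules) : (Scheme.Modules.pullback p).obj ((Scheme.Modules.pullback i).obj F) ≅
    bigModule F V :=
  pullbackOver F i (toBase V) p w

/-- The isomorphism `𝒪_Y ≅ p^* 𝒪_U ≅ p^* i^* F ≅ h^* F` given by `e : 𝒪_U ≅ i^* F` and a
factorization `h = p ≫ i` of an object `h : Y ⟶ X` of the category of a sieve. -/
def bigFrame : structureModule V.obj.left ≅ bigModule F V :=
  (pullbackUnitIso p).symm ≪≫ (Scheme.Modules.pullback p).mapIso e ≪≫ frameOver V p w F

/-- The frame induced by `bigFrame` over an object `W` over `V`. -/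
def bigFrameRes {W : H.arrows.category} (g : W ⟶ V) : structureModule W.obj.left ≅ bigModule F W :=
  bigFrame e W (underlying g ≫ p) (underlying_comp p w g)

theorem bigFrame_one : modMap (bigFrame e V p w).hom (oneSection V.obj.left) =
    (pullbackSection p ((Scheme.Modules.pullback i).obj F) ≫ modMap (frameOver V p w F).hom)
      (modMap e.hom (oneSection U)) :=
  frame_trans_one e p (frameOver V p w F)

theorem frameOver_bigRestriction (F : X.Modules) {W : H.arrows.category} (g : W ⟶ V) :
    (pullbackSection p ((Scheme.Modules.pullback i).obj F) ≫ modMap (frameOver V p w F).hom) ≫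
        bigRestriction F g =
      pullbackSection (underlying g ≫ p) ((Scheme.Modules.pullback i).obj F) ≫
        modMap (frameOver W (underlying g ≫ p) (underlying_comp p w g) F).hom :=
  bigRes_comp F i (toBase V) (toBase W) p (underlying g) w (underlying_toBase g) _

theorem bigRestriction_bigFrame {W : H.arrows.category} (g : W ⟶ V) :
    bigRestriction F g (modMap (bigFrame e V p w).hom (oneSection V.obj.left)) =
      modMap (bigFrameRes e V p w g).hom (oneSection W.obj.left) :=
  eq_of_comp_eq (frameOver_bigRestriction V p w F g)
    (bigFrame_one e V p w) (bigFrame_one e W (underlying g ≫ p) (underlying_comp p w g))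

/-- The rank one trivialization of the big extension of `F` over `V` induced by an isomorphism
`𝒪_U ≅ i^* F` and a factorization of `V ⟶ X` through `i : U ⟶ X`. -/
def frameTrivialization : Trivialization (bigExtension H F) V :=
  Trivialization.ofIso (bigModule F) (bigRestriction F) (bigRestriction_smul F)
    (bigRestriction_id F) (bigRestriction_comp F) V (bigFrame e V p w) (bigFrameRes e V p w)
    (bigRestriction_bigFrame e V p w)

end Frames

end BigExtension

section ProjectiveSpace

/-- The ring `ℤ[x_0, …, x_r]`. -/
abbrev CoordinateRing (r : ℕ) : Type u := MvPolynomial (Fin (r + 1)) (ULift.{u} ℤ)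

/-- The grading of `ℤ[x_0, …, x_r]` by degree. -/
abbrev coordinateGrading (r : ℕ) : ℕ → Submodule (ULift.{u} ℤ) (CoordinateRing.{u} r) :=
  MvPolynomial.homogeneousSubmodule (Fin (r + 1)) (ULift.{u} ℤ)

instance coordinateGradedRing (r : ℕ) : GradedRing (coordinateGrading.{u} r) :=
  MvPolynomial.gradedAlgebra

/-- `Proj ℤ[x_0, …, x_r]`. -/
abbrev integralProjectiveSpace (r : ℕ) : Scheme.{u} := Proj (coordinateGrading.{u} r)

/-- The coordinate `x_k`. -/
abbrev coordinate (r : ℕ) (k : Fin (r + 1)) : CoordinateRing.{u} r := MvPolynomial.X k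

theorem coordinate_mem (r : ℕ) (k : Fin (r + 1)) :
    coordinate.{u} r k ∈ coordinateGrading.{u} r 1 :=
  MvPolynomial.isHomogeneous_X _ k

/-- The projective space `ℙ^r_X = X ×_ℤ Proj ℤ[x_0, …, x_r]`. -/
def ProjectiveSpace (r : ℕ) (X : Scheme.{u}) : Scheme.{u} :=
  Limits.pullback (terminal.from X) (terminal.from (integralProjectiveSpace.{u} r))

/-- The open subset `D₊(x_k)` of `Proj ℤ[x_0, …, x_r]`. -/
abbrev integralChart (r : ℕ) (k : Fin (r + 1)) : (integralProjectiveSpace.{u} r).Opens :=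
  Proj.basicOpen (coordinateGrading.{u} r) (coordinate r k)

/-- Multiplication by `x_k ^ n`, as an isomorphism from the structure sheaf of `D₊(x_k)` to
the restriction of `𝒪(n)`. -/
def integralChartIso (r : ℕ) (n : ℤ) (k : Fin (r + 1)) :
    structureModule (integralChart.{u} r k).toScheme ≅
      (Scheme.Modules.pullback (integralChart.{u} r k).ι).obj
        (twistedSheaf (coordinateGrading.{u} r) n) :=
  asIso (mulPow (coordinateGrading.{u} r) n (coordinate r k) (coordinate_mem r k)) ≪≫
    (Scheme.Modules.restrictFunctorIsoPullback (integralChart.{u} r k).ι).app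
      (twistedSheaf (coordinateGrading.{u} r) n)

variable (r : ℕ) (X : Scheme.{u})

/-- The projection `ℙ^r_X ⟶ Proj ℤ[x_0, …, x_r]`. -/
def toIntegral : ProjectiveSpace r X ⟶ integralProjectiveSpace.{u} r :=
  Limits.pullback.snd _ _

/-- The open subscheme `U_k` of `ℙ^r_X` where `x_k` does not vanish. -/
def chart (k : Fin (r + 1)) : (ProjectiveSpace r X).Opens :=
  toIntegral r X ⁻¹ᵁ integralChart r k

/-- The projection `U_k ⟶ D₊(x_k)`. -/
def chartToIntegral (k : Fin (r + 1)) :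
    (chart r X k).toScheme ⟶ (integralChart.{u} r k).toScheme :=
  toIntegral r X ∣_ integralChart r k

/-- The sieve on `ℙ^r_X` generated by the inclusions `U_k ⟶ ℙ^r_X`. -/
def chartSieve : Sieve (ProjectiveSpace r X) :=
  Sieve.ofArrows (fun k => (chart r X k).toScheme) (fun k => (chart r X k).ι)

theorem iSup_integralChart : ⨆ k, integralChart.{u} r k = ⊤ := by
  refine Proj.iSup_basicOpen_eq_top' (coordinateGrading.{u} r) (coordinate.{u} r)
    (fun k => ⟨1, coordinate_mem r k⟩) (eq_top_iff.mpr fun q _ => ?_)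
  induction q using MvPolynomial.induction_on with
  | C a =>
    have h : (MvPolynomial.C a : CoordinateRing.{u} r) ∈ coordinateGrading.{u} r 0 :=
      MvPolynomial.isHomogeneous_C _ a
    exact Subalgebra.algebraMap_mem (Algebra.adjoin (coordinateGrading.{u} r 0) _)
      (⟨MvPolynomial.C a, h⟩ : coordinateGrading.{u} r 0)
  | add q q' hq hq' => exact add_mem (hq trivial) (hq' trivial)
  | mul_X q k hq => exact mul_mem (hq trivial) (Algebra.subset_adjoin ⟨k, rfl⟩)

theorem iSup_chart : ⨆ k, chart r X k = ⊤ := by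
  have h := congrArg (fun V => toIntegral r X ⁻¹ᵁ V) (iSup_integralChart r)
  simp only [Scheme.Hom.preimage_iSup] at h
  exact h

theorem chartSieve_mem : chartSieve r X ∈ Scheme.zariskiTopology (ProjectiveSpace r X) := by
  have h := (Scheme.openCoverOfIsOpenCover _ (chart r X) (iSup_chart r X)).mem_grothendieckTopology
  exact h

/-- The sheaf of modules `𝒪(n)` on `ℙ^r_X`, the pullback of `𝒪(n)` on `Proj ℤ[x_0, …, x_r]`. -/
def serreTwist (n : ℤ) : (ProjectiveSpace r X).Modules :=
  (Scheme.Modules.pullback (toIntegral r X)).obj (twistedSheaf (coordinateGrading.{u} r) n)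

/-- The isomorphism `𝒪_{U_k} ≅ i_k^* 𝒪(n)` given by multiplication by `x_k ^ n`: the pullback
of multiplication by `x_k ^ n` on `D₊(x_k) ⊆ Proj ℤ[x_0, …, x_r]`. -/
def chartIso (n : ℤ) (k : Fin (r + 1)) :
    structureModule (chart r X k).toScheme ≅
      (Scheme.Modules.pullback (chart r X k).ι).obj (serreTwist r X n) :=
  (pullbackUnitIso (chartToIntegral r X k)).symm ≪≫
    (Scheme.Modules.pullback (chartToIntegral r X k)).mapIso
      (integralChartIso r n k) ≪≫
    pullbackOver (twistedSheaf (coordinateGrading.{u} r) n) (integralChart r k).ι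
      ((chart r X k).ι ≫ toIntegral r X) (chartToIntegral r X k) (morphismRestrict_ι _ _) ≪≫
    (pullbackOver (twistedSheaf (coordinateGrading.{u} r) n) (toIntegral r X)
      ((chart r X k).ι ≫ toIntegral r X) (chart r X k).ι rfl).symm

variable {r X} in
/-- `h` factors through the inclusion of the chart `U_k`. -/
def FactorsThroughChart {Y : Scheme.{u}} (h : Y ⟶ ProjectiveSpace r X) (k : Fin (r + 1)) : Prop :=
  ∃ p : Y ⟶ (chart r X k).toScheme, p ≫ (chart r X k).ι = h

open Classical in
/-- The largest `k` such that `V ⟶ ℙ^r_X` factors through `U_k`. -/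
def chartIndex (V : (chartSieve r X).arrows.category) : Fin (r + 1) :=
  (Finset.univ.filter (FactorsThroughChart (toBase V))).max' (by
    obtain ⟨k, p, hp⟩ := (Sieve.mem_ofArrows_iff _ _ _).mp V.property
    exact ⟨k, Finset.mem_filter.mpr ⟨Finset.mem_univ _, p, hp.symm⟩⟩)

theorem factorsThroughChart_chartIndex (V : (chartSieve r X).arrows.category) :
    FactorsThroughChart (toBase V) (chartIndex r X V) := by
  classical
  exact (Finset.mem_filter.mp (Finset.max'_mem _ _)).2

/-- The trivializations of `𝒪(n)` defined by `x_k ^ n` for the largest possible `k`. -/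
def chartTrivialization (n : ℤ) (V : (chartSieve r X).arrows.category) :
    Trivialization (bigExtension (chartSieve r X) (serreTwist r X n)) V :=
  frameTrivialization (chartIso r X n (chartIndex r X V)) V
    (factorsThroughChart_chartIndex r X V).choose
    (factorsThroughChart_chartIndex r X V).choose_spec

/-- The canonical standard line bundle `𝒪(n)` on `ℙ^r_X`: the standardization of the
sheaf `𝒪(n)`, extended to the big Zariski site. -/
def twistingBundle (n : ℤ) : StandardVectorBundle (ProjectiveSpace r X) :=
  StandardVectorBundle.standardize (chartSieve_mem r X)
    (bigExtension (chartSieve r X) (serreTwist r X n)) (chartTrivialization r X n)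

/-- `𝒪(n)` is a standard line bundle: it has rank one on every object. -/
theorem twistingBundle_rank (n : ℤ) (V : (twistingBundle r X n).sieve.arrows.category) :
    (twistingBundle r X n).rank V = 1 :=
  rfl

end ProjectiveSpace

section Infinity

theorem isUnit_eval_coordinate :
    IsUnit (MvPolynomial.eval ![0, 1] (coordinate.{u} 1 1) : ULift.{u} ℤ) := by
  rw [MvPolynomial.eval_X]
  exact isUnit_one

/-- The ring homomorphism `f / x_1 ^ m ↦ f(0, 1)` from the degree zero part of `ℤ[x_0, x_1, 1 / x_1]`
to `ℤ`. -/
def evalInfinity :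
    HomogeneousLocalization.Away (coordinateGrading.{u} 1) (coordinate.{u} 1 1) →+* ULift.{u} ℤ :=
  (IsLocalization.Away.lift (S := Localization.Away (coordinate.{u} 1 1)) (coordinate.{u} 1 1)
    isUnit_eval_coordinate).comp
    (algebraMap (HomogeneousLocalization.Away (coordinateGrading.{u} 1) (coordinate.{u} 1 1))
      (Localization.Away (coordinate.{u} 1 1)))

/-- The point `[0 : 1]` of `Proj ℤ[x_0, x_1]`, as a morphism from `Spec ℤ`. It lies in `D₊(x_1)`,
the spectrum of the degree zero part of `ℤ[x_0, x_1, 1 / x_1]`. -/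
def integralInfinity : Spec (.of (ULift.{u} ℤ)) ⟶ integralProjectiveSpace.{u} 1 :=
  Spec.map (CommRingCat.ofHom evalInfinity) ≫
    Proj.awayι (coordinateGrading.{u} 1) (coordinate.{u} 1 1) (coordinate_mem 1 1) one_pos

/-- The section `∞ = [0 : 1] : X ⟶ ℙ^1_X`. -/
def infinityPoint (X : Scheme.{u}) : X ⟶ ProjectiveSpace 1 X :=
  Limits.pullback.lift (𝟙 X) (specULiftZIsTerminal.from X ≫ integralInfinity)
    (terminalIsTerminal.hom_ext _ _)

end Infinity

end StandardBundle

end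

namespace StandardBundle

/-! Strict equality of standard line bundles is a question about three pieces of data: the sieve,
the ranks and the restriction maps, since the values are by definition the free modules $\mathcal
O(Y)^{n_Y}$ and all other fields are proofs. The ranks are one by construction, so the sieve and the
restriction maps carry the content.

The point $\infty$ lies in the chart $U_1$ (`infinityPoint_factorsThroughChart`). Hence every
composite $Y \to X \to \mathbb P^1_X$ through $\infty$ factors through $U_1$. This makes the pulled
back sieve contain the identity of $X$, so it is maximal. Since $1$ is the largest index on $\mathbb
P^1$ and the convention picks the largest available chart, the chart chosen for each such $Y$ is
always $U_1$ (`chartIndex_eq_last`).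

All frames of $\mathcal O(n)$ that enter the pullback are therefore pulled back from the single
frame $x_1^n$ on $U_1$, and no transition function $(x_0/x_1)^{\pm n}$ ever appears. By
functoriality of pullback, restriction carries the frame at $Y$ to the frame at $Z$
(`bigRestriction_bigFrame`), so in standardized coordinates it sends $1$ to $1$
(`twistingBundle_res_one`). A semilinear map between free modules of rank one is determined by the
image of the basis, so it is the usual restriction of functions
(`StandardVectorBundle.eq_trivial_one`).

The only property of $\infty$ that is used is that it factors through the last chart; the exponent
$n$ plays no role. -/

/-! ### Restriction maps determined by the standard basis -/

/-- A standard vector bundle on the maximal sieve, of constant rank one, whose restriction maps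
preserve the standard basis is the trivial standard line bundle. -/
theorem StandardVectorBundle.eq_trivial_one {X : Scheme.{u}} (E : StandardVectorBundle X)
    (hsieve : E.sieve = ⊤) (hrank : ∀ V, E.rank V = 1)
    (hres : ∀ {V W : E.sieve.arrows.category} (g : W ⟶ V), E.res g (fun _ => 1) = fun _ => 1) :
    E = StandardVectorBundle.trivial X 1 := by
  obtain ⟨H, hH, rank, res, res_id, res_comp, bij⟩ := E
  dsimp only at hsieve hrank hres
  subst hsieve
  -- Once the sieve and the rank function have been substituted, both families of restriction maps
  -- have the same type up to unfolding, so they can be compared by a plain equality instead of a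
  -- heterogeneous one.
  obtain rfl : rank = fun _ => 1 := funext hrank
  have key : @res = @(StandardVectorBundle.trivial X 1).res := by
    funext V W g
    refine LinearMap.ext fun a => ?_
    -- In rank one every vector is a scalar times the basis vector, so semilinearity reduces the
    -- computation to the image of the basis vector, which `hres` provides.
    have ha : a = a 0 • (fun _ : Fin 1 => (1 : globalSections V)) := by
      funext j
      rw [Subsingleton.elim j 0]
      exact (mul_one _).symm
    have h1 : res g a = globalRes g (a 0) • (fun _ : Fin 1 => (1 : globalSections W)) := by
      conv_lhs => rw [ha]
      rw [LinearMap.map_smulₛₗ, hres g]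
    rw [h1]
    funext j
    rw [Subsingleton.elim j 0]
    exact mul_one _
  -- Unfolding exposes two applications of the same constructor. They differ only in the restriction
  -- maps, which `key` identifies, and in proofs.
  unfold StandardVectorBundle.trivial at key ⊢
  congr

/-- The standardized restriction is $\varphi_W^{-1}\circ E(g)\circ\varphi_V$, and each $\varphi_T$
sends $(1,\dots,1)$ to the sum of its frame. The all-ones vector and the sum of the frame make sense
in every rank, so no rewriting of the index types `Fin (φ V).rank` is needed; in rank one they are
the basis vector and the frame itself. -/
theorem standardize_res_one {X : Scheme.{u}} {H : Sieve X} (hH : H ∈ Scheme.zariskiTopology X)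
    (E : SievePresheaf H) (φ : ∀ V : H.arrows.category, Trivialization E V)
    {V W : H.arrows.category} (g : W ⟶ V)
    (h : E.res g (∑ j, (φ V).basis j) = ∑ j, (φ W).basis j) :
    (StandardVectorBundle.standardize hH E φ).res g (fun _ => 1) = fun _ => 1 := by
  have hone (T : H.arrows.category) :
      (φ T).equiv (fun _ => 1) = ∑ j, (φ T).basis j := by
    refine (LinearEquiv.ofBijective_apply _ _).trans ?_
    rw [Fintype.linearCombination_apply]
    exact Finset.sum_congr rfl fun j _ => one_smul _ _
  change (φ W).equiv.symm (E.res g ((φ V).equiv fun _ => 1)) = _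
  rw [hone, h, ← hone, LinearEquiv.symm_apply_apply]
  rfl

/-! ### Chart indices and frames of the twisting sheaf -/

section Charts

variable {r : ℕ} {X : Scheme.{u}}

/-- The trivialization is defined by a factorization obtained from `choose`. The inclusion of a
chart is a monomorphism, so that factorization is unique and may be replaced by any convenient `p`.
Keeping `k` as a variable with the equation `hk` allows frames at different objects to be compared
on one and the same chart. -/
theorem chartTrivialization_basis (n : ℤ) (V : (chartSieve r X).arrows.category)
    (k : Fin (r + 1)) (hk : chartIndex r X V = k) (p : V.obj.left ⟶ (chart r X k).toScheme)
    (w : p ≫ (chart r X k).ι = toBase V) :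
    ∑ j, (chartTrivialization r X n V).basis j =
      modMap (bigFrame (chartIso r X n k) V p w).hom (oneSection V.obj.left) := by
  subst hk
  obtain rfl : (factorsThroughChart_chartIndex r X V).choose = p :=
    (cancel_mono (chart r X (chartIndex r X V)).ι).mp
      ((factorsThroughChart_chartIndex r X V).choose_spec.trans w.symm)
  exact Fin.sum_univ_one _

/-- The restriction maps of `𝒪(n)` preserve the standard basis along morphisms between objects
with the same chart index. -/
theorem twistingBundle_res_one (n : ℤ) {V W : (chartSieve r X).arrows.category} (g : W ⟶ V)
    (h : chartIndex r X W = chartIndex r X V) :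
    (twistingBundle r X n).res g (fun _ => 1) = fun _ => 1 := by
  refine standardize_res_one _ _ _ g ?_
  obtain ⟨p, w⟩ := factorsThroughChart_chartIndex r X V
  -- For `W` the factorization is taken to be the one of `V` precomposed with `g`. Both frames then
  -- come from the same frame on the chart, and their compatibility is the functoriality of
  -- pullback.
  rw [chartTrivialization_basis n V _ rfl p w,
    chartTrivialization_basis n W _ h (underlying g ≫ p) (underlying_comp p w g)]
  exact bigRestriction_bigFrame (chartIso r X n (chartIndex r X V)) V p w g

theorem le_chartIndex (V : (chartSieve r X).arrows.category) (k : Fin (r + 1))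
    (h : FactorsThroughChart (toBase V) k) : k ≤ chartIndex r X V := by
  classical
  exact Finset.le_max' _ _ (Finset.mem_filter.mpr ⟨Finset.mem_univ _, h⟩)

/-- Here the convention of taking the largest index matters: a factorization through the last chart
settles the choice, without asking whether other charts are available. In particular the empty
scheme, which factors through every chart, needs no separate treatment. -/
theorem chartIndex_eq_last (V : (chartSieve r X).arrows.category)
    (h : FactorsThroughChart (toBase V) (Fin.last r)) : chartIndex r X V = Fin.last r :=
  le_antisymm (Fin.le_last _) (le_chartIndex V _ h)

theorem FactorsThroughChart.comp {Y Z : Scheme.{u}} {h : Y ⟶ ProjectiveSpace r X}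
    {k : Fin (r + 1)} (hh : FactorsThroughChart h k) (g : Z ⟶ Y) :
    FactorsThroughChart (g ≫ h) k := by
  obtain ⟨p, rfl⟩ := hh
  exact ⟨g ≫ p, Category.assoc _ _ _⟩

end Charts

/-! ### The point at infinity and the conclusion -/

/-- The chart is the preimage of $D_+(x_1)$ under the projection to $\operatorname{Proj}\mathbb
Z[x_0,x_1]$, and the projection of $\infty$ is built through $D_+(x_1)$ by definition. The values of
the coordinates at $\infty$ are not needed. -/
theorem infinityPoint_factorsThroughChart (X : Scheme.{u}) :
    FactorsThroughChart (infinityPoint X) (Fin.last 1) := by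
  have hto : infinityPoint X ≫ toIntegral 1 X = specULiftZIsTerminal.from X ≫ integralInfinity :=
    Limits.pullback.lift_snd _ _ _
  -- A morphism lifts through an open immersion as soon as its set-theoretic image lies in the
  -- range, so it suffices to check points.
  have hrange : Set.range (infinityPoint X) ⊆ Set.range (chart 1 X (Fin.last 1)).ι := by
    rw [Scheme.Opens.range_ι]
    rintro _ ⟨x, rfl⟩
    change toIntegral 1 X (infinityPoint X x) ∈ integralChart 1 (Fin.last 1)
    rw [← Scheme.Hom.comp_apply, hto, integralInfinity, Scheme.Hom.comp_apply,
      Scheme.Hom.comp_apply]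
    -- The last factor of `integralInfinity` is the open immersion onto $D_+(x_1)$, so every point
    -- in its image lies there.
    have h := Proj.opensRange_awayι (coordinateGrading.{u} 1) (coordinate.{u} 1 1)
      (coordinate_mem 1 1) one_pos
    have hl : integralChart.{u} 1 (Fin.last 1) =
      Proj.basicOpen (coordinateGrading.{u} 1) (coordinate.{u} 1 1) := rfl
    rw [hl, ← h]
    exact ⟨_, rfl⟩
  exact ⟨IsOpenImmersion.lift (chart 1 X (Fin.last 1)).ι (infinityPoint X) hrange,
    IsOpenImmersion.lift_fac _ _ _⟩

end StandardBundle

theorem proposition3p9 (X : AlgebraicGeometry.Scheme.{u}) (n : ℤ) :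
    (StandardBundle.twistingBundle 1 X n).pullback (StandardBundle.infinityPoint X) =
      StandardBundle.StandardVectorBundle.trivial X 1 := by
  have hfac := StandardBundle.infinityPoint_factorsThroughChart X
  refine StandardBundle.StandardVectorBundle.eq_trivial_one _ ?_ (fun _ => rfl) ?_
  -- The pulled back sieve is maximal because it contains the identity of $X$, that is, because
  -- $\infty$ itself belongs to the sieve generated by the charts.
  · refine (Sieve.id_mem_iff_eq_top).mp ?_
    change StandardBundle.chartSieve 1 X (𝟙 X ≫ StandardBundle.infinityPoint X)
    obtain ⟨p, hp⟩ := hfac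
    rw [Category.id_comp]
    exact (Sieve.mem_ofArrows_iff _ _ _).mpr ⟨Fin.last 1, p, hp.symm⟩
  · intro V W g
    -- By definition, restriction of the pullback along `g` is restriction of $\mathcal O(n)$ along
    -- the image of `g` over $\mathbb P^1_X$. What remains is that source and target have the same
    -- chart index; both equal the last one since their structure morphisms pass through $\infty$.
    refine StandardBundle.twistingBundle_res_one n
      ((StandardBundle.StandardVectorBundle.pullbackSieveFunctor
        (StandardBundle.infinityPoint X) (StandardBundle.chartSieve 1 X)).map g) ?_
    rw [StandardBundle.chartIndex_eq_last _ (hfac.comp W.obj.hom),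
      StandardBundle.chartIndex_eq_last _ (hfac.comp V.obj.hom)]
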